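/- **Theorem.** Let $X_1,\dots,X_n$ be independent random vectors in $\mathbb{R}^d$ with common distribution $\mu$, and let $\mu_n = \frac1n\sum_{i=1}^n \delta_{X_i}$ be their empirical measure. Let $\mathcal{A}$ be a non-empty class of Borel subsets of $\mathbb{R}^d$ that is pointwise measurable, i.e. there is an at most countable subclass $\mathcal{A}_0\subseteq\mathcal{A}$ such that for every $A\in\mathcal{A}$ there is a sequence $(A_k)_{k\in\mathbb N}$ in $\mathcal{A}_0$ with $\lim_{k\to\infty}\mathbf{1}_{A_k}(x)=\mathbf{1}_A(x)$ for every $x\in\mathbb{R}^d$. Let $\mathbb{A}\subseteq\mathbb{R}^d$ be a Borel set that contains every $A\in\mathcal{A}$, and put $p=\mu(\mathbb{A})$. For an integer $m\ge 0$ let $$S_{\mathcal{A}}(m)=\max_{x_1,\dots,x_m\in\mathbb{R}^d}\bigl|\{\{x_1,\dots,x_m\}\cap A : A\in\mathcal{A}\}\bigr|$$ be the shattering coefficient of $\mathcal{A}$, and for real $x\ge 0$ put $S_{\mathcal{A}}(x)=S_{\mathcal{A}}(\lfloor x\rfloor)$. Let $\delta\in(0,1)$. If $np\ge 4\log(4/\delta)$,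 then with probability at least $1-\delta$, $$\sup_{A\in\mathcal{A}}|\mu_n(A)-\mu(A)|\le \frac{2}{3n}\log(4/\delta)+\sqrt{\frac pn}\left(\sqrt{2\log(4/\delta)}+2\sqrt{\log(8/\delta)+\log S_{\mathcal{A}}(4np)}+1\right).$$ -/

import Mathlib

open MeasureTheory ProbabilityTheory Filter Topology
open scoped ENNReal

namespace RareVC

/-- The shattering coefficient `S_𝒜(n)`: the largest number of distinct sets `{x₁, …, xₙ} ∩ A`,
`A ∈ 𝒜`, over all choices of points `x₁, …, xₙ` (a maximum, see `isGreatest_shatterCoeff`). -/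
noncomputable def shatterCoeff {E : Type*} (𝒜 : Set (Set E)) (n : ℕ) : ℕ :=
  ⨆ x : Fin n → E, ((fun A : Set E => Set.range x ∩ A) '' 𝒜).ncard

theorem ncard_traces_le {E : Type*} (𝒜 : Set (Set E)) {n : ℕ} (x : Fin n → E) :
    ((fun A : Set E => Set.range x ∩ A) '' 𝒜).ncard ≤ 2 ^ n := by
  have hfin : (Set.range x).Finite := Set.finite_range x
  have hsub : (fun A : Set E => Set.range x ∩ A) '' 𝒜 ⊆ 𝒫 (Set.range x) := by
    rintro _ ⟨A, -, rfl⟩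
    exact Set.inter_subset_left
  have hcard : (Set.range x).ncard ≤ n := by
    have h := Set.ncard_image_le (f := x) (Set.finite_univ (α := Fin n))
    simpa [Set.image_univ, Set.ncard_univ] using h
  calc _ ≤ (𝒫 (Set.range x)).ncard := Set.ncard_le_ncard hsub hfin.finite_subsets
    _ = 2 ^ (Set.range x).ncard := Set.ncard_powerset _ hfin
    _ ≤ 2 ^ n := Nat.pow_le_pow_right (by norm_num) hcard

theorem isGreatest_shatterCoeff {E : Type*} [Nonempty E] (𝒜 : Set (Set E)) (n : ℕ) :
    IsGreatest (Set.range fun x : Fin n → E =>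
      ((fun A : Set E => Set.range x ∩ A) '' 𝒜).ncard) (shatterCoeff 𝒜 n) := by
  have hb : BddAbove (Set.range fun x : Fin n → E =>
      ((fun A : Set E => Set.range x ∩ A) '' 𝒜).ncard) := by
    refine ⟨2 ^ n, ?_⟩
    rintro _ ⟨x, rfl⟩
    exact ncard_traces_le 𝒜 x
  exact ⟨Nat.sSup_mem (Set.range_nonempty _) hb, fun _ h => le_csSup hb h⟩

/-- The shattering coefficient at a real argument: `S_𝒜(x) := S_𝒜(⌊x⌋)`, for `x ≥ 0`. -/
noncomputable def shatterCoeffReal {E : Type*} (𝒜 : Set (Set E)) (x : ℝ) : ℕ :=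
  shatterCoeff 𝒜 ⌊x⌋₊

/-- The empirical measure `n⁻¹ ∑ᵢ δ_{xᵢ}` of the points `x₁, …, xₙ`. -/
noncomputable def empiricalMeasure {E : Type*} [MeasurableSpace E] {n : ℕ} (x : Fin n → E) :
    Measure E :=
  (n : ℝ≥0∞)⁻¹ • ∑ i, Measure.dirac (x i)

/-- Pointwise measurability of a class of sets: there is an at most countable subclass such that
the indicator of every member of the class is the pointwise limit of indicators of members of
the subclass. -/
def PointwiseMeasurable {E : Type*} (𝒜 : Set (Set E)) : Prop :=
  ∃ 𝒜₀ : Set (Set E), 𝒜₀ ⊆ 𝒜 ∧ 𝒜₀.Countable ∧ ∀ A ∈ 𝒜, ∃ B : ℕ → Set E,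
    (∀ k, B k ∈ 𝒜₀) ∧
      ∀ x, Tendsto (fun k => (B k).indicator (fun _ => (1 : ℝ)) x) atTop
        (𝓝 (A.indicator (fun _ => (1 : ℝ)) x))

end RareVC

namespace RareVC

/-! Only the sample points that fall into `R` matter, and there are about `np` of them. Let `N` be
their number. For `A ⊆ R`, the count of `A` minus `n μ(A)` splits into the count minus `N μ(A)/p`,
plus `(N - np) μ(A)/p`.

The second term is at most `|N - np|`, which Bernstein controls (`measureReal_bernstein_le`). For
the first, condition on the exact set of indices whose points lie in `R` (`patternEvent`). The
points with these indices remain independent and each has law `μ(· | R)`, so a Vapnik–Chervonenkis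
bound (`measure_exists_dev_le`) applies to `N` points instead of `n`. On the Bernstein event `N ≤
2np`; the ghost sample doubles this, whence `S(4np)`.

The VC bound comes from symmetrization by a ghost sample, invariance under swapping the two halves
of each pair, and Hoeffding's inequality for each trace. Everything is done over the countable
subclass and transferred to the whole class by pointwise limits. -/

/-! ### Rademacher sums -/

theorem sum_exp_rademacher_le {ι : Type*} [Fintype ι] [DecidableEq ι] (c : ι → ℝ)
    (hc : ∀ i, |c i| ≤ 1) (s : ℝ) :
    ∑ σ : ι → Bool, Real.exp (s * ∑ i, (if σ i then c i else -c i))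
      ≤ 2 ^ Fintype.card ι * Real.exp (Fintype.card ι * (s ^ 2 / 2)) := by
  have h1 : ∑ σ : ι → Bool, Real.exp (s * ∑ i, (if σ i then c i else -c i))
      = ∏ i, ∑ b : Bool, Real.exp (s * (if b then c i else -c i)) := by
    rw [Finset.prod_univ_sum, Fintype.piFinset_univ]
    refine Finset.sum_congr rfl fun σ _ => ?_
    rw [Finset.mul_sum, Real.exp_sum]
  rw [h1]
  calc ∏ i, ∑ b : Bool, Real.exp (s * (if b then c i else -c i))
      ≤ ∏ _i : ι, 2 * Real.exp (s ^ 2 / 2) := by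
        refine Finset.prod_le_prod (fun i _ => by positivity) fun i _ => ?_
        have h2 := Real.cosh_le_exp_half_sq (s * c i)
        have h3 : Real.exp ((s * c i) ^ 2 / 2) ≤ Real.exp (s ^ 2 / 2) := by
          have : c i ^ 2 ≤ 1 := (sq_le_one_iff_abs_le_one _).2 (hc i)
          rw [Real.exp_le_exp, mul_pow]
          have := mul_le_of_le_one_right (sq_nonneg s) this
          linarith
        rw [Real.cosh_eq] at h2
        simp only [Fintype.sum_bool, if_true, Bool.false_eq_true, if_false, mul_neg]
        linarith
    _ = _ := by
        rw [Finset.prod_const, mul_pow, ← Real.exp_nat_mul]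
        rfl

/-- Chernoff's method with exponent `t / v`. Allowing any `v` above the number of terms lets one
bound serve all sample sizes up to `v`. -/
theorem card_lt_rademacher_le {ι : Type*} [Fintype ι] [DecidableEq ι] (c : ι → ℝ)
    (hc : ∀ i, |c i| ≤ 1) {v t : ℝ} (hv : 0 < v) (hcard : Fintype.card ι ≤ v) (ht : 0 ≤ t) :
    ((Finset.univ.filter fun σ : ι → Bool => t < ∑ i, (if σ i then c i else -c i)).card : ℝ)
      ≤ 2 ^ Fintype.card ι * Real.exp (-t ^ 2 / (2 * v)) := by
  have h := sum_exp_rademacher_le c hc (t / v)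
  set F := Finset.univ.filter fun σ : ι → Bool => t < ∑ i, (if σ i then c i else -c i)
  have h1 : (F.card : ℝ) * Real.exp (t / v * t)
      ≤ ∑ σ : ι → Bool, Real.exp (t / v * ∑ i, (if σ i then c i else -c i)) := by
    calc (F.card : ℝ) * Real.exp (t / v * t) = ∑ _σ ∈ F, Real.exp (t / v * t) := by
          rw [Finset.sum_const, nsmul_eq_mul]
      _ ≤ ∑ σ ∈ F, Real.exp (t / v * ∑ i, (if σ i then c i else -c i)) := by
          refine Finset.sum_le_sum fun σ hσ => ?_
          have := (Finset.mem_filter.1 hσ).2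
          gcongr
      _ ≤ _ := Finset.sum_le_univ_sum_of_nonneg fun σ => (Real.exp_pos _).le
  have h2 : (F.card : ℝ) ≤ (2 ^ Fintype.card ι * Real.exp (v * ((t / v) ^ 2 / 2)))
      / Real.exp (t / v * t) := by
    rw [le_div_iff₀ (Real.exp_pos _)]
    refine (h1.trans h).trans ?_
    gcongr
  refine h2.trans_eq ?_
  rw [mul_div_assoc, ← Real.exp_sub]
  congr 2
  field_simp
  ring

/-- Hoeffding's inequality for Rademacher sums, as a count of sign patterns. -/
theorem card_lt_abs_rademacher_le {ι : Type*} [Fintype ι] [DecidableEq ι] (c : ι → ℝ)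
    (hc : ∀ i, |c i| ≤ 1) {v t : ℝ} (hv : 0 < v) (hcard : Fintype.card ι ≤ v) (ht : 0 ≤ t) :
    ((Finset.univ.filter fun σ : ι → Bool => t < |∑ i, (if σ i then c i else -c i)|).card : ℝ)
      ≤ 2 ^ Fintype.card ι * (2 * Real.exp (-t ^ 2 / (2 * v))) := by
  have h1 := card_lt_rademacher_le c hc hv hcard ht
  have h2 := card_lt_rademacher_le (fun i => -c i) (by simpa using hc) hv hcard ht
  have hsub : (Finset.univ.filter fun σ : ι → Bool => t < |∑ i, (if σ i then c i else -c i)|)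
      ⊆ (Finset.univ.filter fun σ : ι → Bool => t < ∑ i, (if σ i then c i else -c i)) ∪
        (Finset.univ.filter fun σ : ι → Bool => t < ∑ i, (if σ i then -c i else - -c i)) := by
    intro σ hσ
    simp only [Finset.mem_union, Finset.mem_filter, Finset.mem_univ, true_and] at hσ ⊢
    have e : ∑ i, (if σ i then -c i else - -c i) = -∑ i, (if σ i then c i else -c i) := by
      rw [← Finset.sum_neg_distrib]
      exact Finset.sum_congr rfl fun i _ => by split_ifs <;> rfl
    rw [e]
    exact lt_abs.1 hσ
  have h3 := (Finset.card_le_card hsub).trans (Finset.card_union_le _ _)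
  have h4 := (Nat.cast_le (α := ℝ)).2 h3
  push_cast at h4
  linarith

/-! ### Traces of a class on finitely many points -/

/-- Pad the family to `m` points with an arbitrary point: traces on the larger family determine
those on the smaller one. -/
theorem ncard_traces_le_shatterCoeff {E : Type*} [Nonempty E] (𝒜 : Set (Set E)) {ι : Type*}
    [Fintype ι] (w : ι → E) {m : ℕ} (hm : Fintype.card ι ≤ m) :
    ((fun A : Set E => Set.range w ∩ A) '' 𝒜).ncard ≤ shatterCoeff 𝒜 m := by
  classical
  have e : ι ↪ Fin m := (Fintype.equivFin ι).toEmbedding.trans (Fin.castLEEmb hm)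
  let x : Fin m → E := Function.extend e w fun _ => Classical.arbitrary E
  have hx : Set.range w ⊆ Set.range x := by
    rintro _ ⟨i, rfl⟩
    exact ⟨e i, e.injective.extend_apply _ _ _⟩
  have himg : (fun A : Set E => Set.range w ∩ A) '' 𝒜
      = (fun B => Set.range w ∩ B) '' ((fun A : Set E => Set.range x ∩ A) '' 𝒜) := by
    rw [Set.image_image]
    refine Set.image_congr fun A _ => ?_
    rw [← Set.inter_assoc, Set.inter_eq_left.2 hx]
  have hfin : ((fun A : Set E => Set.range x ∩ A) '' 𝒜).Finite := by
    refine (Set.finite_range x).finite_subsets.subset ?_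
    rintro _ ⟨A, -, rfl⟩
    exact Set.inter_subset_left
  rw [himg]
  exact (Set.ncard_image_le hfin).trans ((isGreatest_shatterCoeff 𝒜 m).2 ⟨x, rfl⟩)

theorem shatterCoeff_pos {E : Type*} [Nonempty E] {𝒜 : Set (Set E)} (h : 𝒜.Nonempty) (m : ℕ) :
    0 < shatterCoeff 𝒜 m := by
  have h1 := ncard_traces_le_shatterCoeff 𝒜 (Fin.elim0 : Fin 0 → E) (m := m) (by simp)
  refine lt_of_lt_of_le ?_ h1
  refine (Set.ncard_pos ?_).2 (h.image _)
  refine (Set.finite_range (Fin.elim0 : Fin 0 → E)).finite_subsets.subset ?_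
  rintro _ ⟨A, -, rfl⟩
  exact Set.inter_subset_left

/-- Finitely many members of a class, at most `S_𝒜(m)` of them, represent all its traces on
a family of at most `m` points. -/
theorem exists_finset_traces {E : Type*} [Nonempty E] {𝒜 𝒜₀ : Set (Set E)} (h0 : 𝒜₀ ⊆ 𝒜)
    {ι : Type*} [Fintype ι] (w : ι → E) {m : ℕ} (hm : Fintype.card ι ≤ m) :
    ∃ T : Finset (Set E), T.card ≤ shatterCoeff 𝒜 m ∧
      ∀ A ∈ 𝒜₀, ∃ B ∈ T, ∀ i, w i ∈ A ↔ w i ∈ B := by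
  have hfin : ((fun A : Set E => Set.range w ∩ A) '' 𝒜).Finite := by
    refine (Set.finite_range w).finite_subsets.subset ?_
    rintro _ ⟨A, -, rfl⟩
    exact Set.inter_subset_left
  refine ⟨hfin.toFinset, ?_, fun A hA => ⟨Set.range w ∩ A, ?_, fun i => by simp⟩⟩
  · rw [← Set.ncard_eq_toFinset_card _ hfin]
    exact ncard_traces_le_shatterCoeff 𝒜 w hm
  · exact hfin.mem_toFinset.2 ⟨A, h0 hA, rfl⟩

theorem indicator_one_mem_Icc {E : Type*} (A : Set E) (x : E) :
    A.indicator (fun _ => (1 : ℝ)) x ∈ Set.Icc (0 : ℝ) 1 := by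
  by_cases h : x ∈ A <;> simp [h]

theorem measurableSet_exists_lt_abs {E α : Type*} [MeasurableSpace α] {𝒜 : Set (Set E)}
    (hc : 𝒜.Countable) {f : Set E → α → ℝ} (hf : ∀ A ∈ 𝒜, Measurable (f A)) (t : ℝ) :
    MeasurableSet {a | ∃ A ∈ 𝒜, t < |f A a|} := by
  have : {a | ∃ A ∈ 𝒜, t < |f A a|} = ⋃ A ∈ 𝒜, {a | t < |f A a|} := by
    ext a; simp
  rw [this]
  exact MeasurableSet.biUnion hc fun A hA =>
    measurableSet_lt measurable_const (continuous_abs.measurable.comp (hf A hA))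

/-- Among all sign patterns, few make the symmetrized process large at some set of the class. -/
theorem card_swaps_le {E : Type*} [Nonempty E] {𝒜 𝒜₀ : Set (Set E)} (h0 : 𝒜₀ ⊆ 𝒜)
    {ι : Type*} [Fintype ι] [DecidableEq ι] (z : ι → E × E) {m : ℕ} (hm : 2 * Fintype.card ι ≤ m) {v t : ℝ} (hv : 0 < v)
    (hcard : Fintype.card ι ≤ v) (ht : 0 ≤ t) (F : Finset (ι → Bool))
    (hF : ∀ σ ∈ F, ∃ A ∈ 𝒜₀, t < |∑ i, (if σ i then
        A.indicator (fun _ => (1 : ℝ)) (z i).1 - A.indicator (fun _ => (1 : ℝ)) (z i).2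
      else -(A.indicator (fun _ => (1 : ℝ)) (z i).1 - A.indicator (fun _ => (1 : ℝ)) (z i).2))|) :
    (F.card : ℝ) ≤ 2 ^ Fintype.card ι * (shatterCoeff 𝒜 m * (2 * Real.exp (-t ^ 2 / (2 * v)))) := by
  -- Traces are taken on both halves of the pairs at once, so one choice of representatives works
  -- for every sign pattern.
  obtain ⟨T, hT, hrep⟩ := exists_finset_traces h0
    (Sum.elim (fun i => (z i).1) fun i => (z i).2 : ι ⊕ ι → E) (m := m)
    (by rw [Fintype.card_sum]; omega)
  classical
  let c (A : Set E) (i : ι) : ℝ :=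
    A.indicator (fun _ => (1 : ℝ)) (z i).1 - A.indicator (fun _ => (1 : ℝ)) (z i).2
  let G (A : Set E) : Finset (ι → Bool) :=
    Finset.univ.filter fun σ : ι → Bool => t < |∑ i, (if σ i then c A i else -c A i)|
  have hsub : F ⊆ T.biUnion G := by
    intro σ hσ
    obtain ⟨A, hA, hlt⟩ := hF σ hσ
    obtain ⟨B, hB, hAB⟩ := hrep A hA
    refine Finset.mem_biUnion.2 ⟨B, hB, Finset.mem_filter.2 ⟨Finset.mem_univ _, ?_⟩⟩
    have hcAB : c A = c B := by
      funext i
      have h1 : (z i).1 ∈ A ↔ (z i).1 ∈ B := hAB (Sum.inl i)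
      have h2 : (z i).2 ∈ A ↔ (z i).2 ∈ B := hAB (Sum.inr i)
      simp only [c, Set.indicator_apply, h1, h2]
    rw [← hcAB]
    exact hlt
  have hc (A : Set E) (i : ι) : |c A i| ≤ 1 := by
    have h1 := indicator_one_mem_Icc A (z i).1
    have h2 := indicator_one_mem_Icc A (z i).2
    rw [abs_le]
    constructor <;> simp only [c] <;> linarith [h1.1, h1.2, h2.1, h2.2]
  calc (F.card : ℝ) ≤ ((∑ B ∈ T, (G B).card : ℕ) : ℝ) := by
        exact_mod_cast (Finset.card_le_card hsub).trans Finset.card_biUnion_le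
    _ ≤ ∑ _B ∈ T, 2 ^ Fintype.card ι * (2 * Real.exp (-t ^ 2 / (2 * v))) := by
        push_cast
        exact Finset.sum_le_sum fun B _ => card_lt_abs_rademacher_le (c B) (hc B) hv hcard ht
    _ = T.card * (2 ^ Fintype.card ι * (2 * Real.exp (-t ^ 2 / (2 * v)))) := by
        rw [Finset.sum_const, nsmul_eq_mul]
    _ ≤ shatterCoeff 𝒜 m * (2 ^ Fintype.card ι * (2 * Real.exp (-t ^ 2 / (2 * v)))) := by
        gcongr
    _ = _ := by ring

/-! ### Symmetrization and the Vapnik–Chervonenkis inequality -/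

section VapnikChervonenkis

variable {E : Type*} [MeasurableSpace E]

theorem measurable_indicator_one {A : Set E} (hA : MeasurableSet A) :
    Measurable (A.indicator fun _ => (1 : ℝ)) :=
  measurable_const.indicator hA

/-- Chebyshev's inequality for the number of points in a set. -/
theorem measure_pi_abs_sum_indicator_sub_le {ι : Type*} [Fintype ι] (ν : ι → Measure E)
    [∀ i, IsProbabilityMeasure (ν i)] {A : Set E} (hA : MeasurableSet A) {v : ℝ} (hv : 0 < v)
    (hcard : Fintype.card ι ≤ v) :
    Measure.pi ν {y | √(v / 2) < |∑ i, (A.indicator (fun _ => (1 : ℝ)) (y i) - (ν i).real A)|}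
      ≤ 2⁻¹ := by
  have hm := measurable_indicator_one hA
  have hL (i : ι) : MemLp (A.indicator fun _ => (1 : ℝ)) 2 (ν i) :=
    memLp_of_bounded (.of_forall (indicator_one_mem_Icc A)) hm.aestronglyMeasurable 2
  have hvar : Var[∑ i, fun y : ι → E => A.indicator (fun _ => (1 : ℝ)) (y i); Measure.pi ν]
      ≤ v / 4 := by
    rw [variance_sum_pi hL]
    calc _ ≤ ∑ _i : ι, ((1 - 0) / 2 : ℝ) ^ 2 := Finset.sum_le_sum fun i _ =>
          variance_le_sq_of_bounded (.of_forall (indicator_one_mem_Icc A)) hm.aemeasurable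
      _ ≤ v / 4 := by
          rw [Finset.sum_const, nsmul_eq_mul, Finset.card_univ]
          linarith
  have hLi (i : ι) : MemLp (fun y : ι → E => A.indicator (fun _ => (1 : ℝ)) (y i)) 2
      (Measure.pi ν) := (hL i).comp_measurePreserving (measurePreserving_eval ν i)
  have hint : (Measure.pi ν)[∑ i, fun y : ι → E => A.indicator (fun _ => (1 : ℝ)) (y i)]
      = ∑ i, (ν i).real A := by
    simp only [Finset.sum_apply]
    rw [integral_finsetSum _ fun i _ => (hLi i).integrable (by norm_num)]
    refine Finset.sum_congr rfl fun i _ => ?_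
    rw [integral_comp_eval (μ := ν) hm.aestronglyMeasurable, integral_indicator_const _ hA]
    simp
  -- Variance at most `v / 4` against squared threshold `v / 2` gives probability at most one half.
  have hc : 0 < √(v / 2) := by positivity
  have hch := meas_ge_le_variance_div_sq (memLp_finsetSum' Finset.univ fun i _ => hLi i) hc
  rw [hint] at hch
  refine (measure_mono fun y hy => ?_).trans (hch.trans ?_)
  · simp only [Set.mem_ofPred_eq, Finset.sum_sub_distrib] at hy
    simpa using hy.le
  · rw [Real.sq_sqrt (by positivity)]
    calc ENNReal.ofReal _ ≤ ENNReal.ofReal 2⁻¹ := by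
          refine ENNReal.ofReal_le_ofReal ?_
          rw [div_le_iff₀ (by positivity)]
          linarith
      _ = 2⁻¹ := by rw [ENNReal.ofReal_inv_of_pos two_pos]; simp

/-- Symmetrization by a ghost sample. -/
theorem measure_pi_exists_le_two_mul {𝒜₀ : Set (Set E)} (hcount : 𝒜₀.Countable)
    (hmeas : ∀ A ∈ 𝒜₀, MeasurableSet A) {ι : Type*} [Fintype ι] (ν : ι → Measure E)
    [∀ i, IsProbabilityMeasure (ν i)] {v : ℝ} (hv : 0 < v) (hcard : Fintype.card ι ≤ v) (t : ℝ) :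
    Measure.pi ν {y | ∃ A ∈ 𝒜₀, t + √(v / 2) <
        |∑ i, (A.indicator (fun _ => (1 : ℝ)) (y i) - (ν i).real A)|}
      ≤ 2 * Measure.pi (fun i => (ν i).prod (ν i)) {z | ∃ A ∈ 𝒜₀, t < |∑ i,
        (A.indicator (fun _ => (1 : ℝ)) (z i).1 - A.indicator (fun _ => (1 : ℝ)) (z i).2)|} := by
  set dev : Set E → (ι → E) → ℝ := fun A y =>
    ∑ i, (A.indicator (fun _ => (1 : ℝ)) (y i) - (ν i).real A)
  have hdev (A : Set E) (hA : A ∈ 𝒜₀) : Measurable (dev A) :=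
    Finset.measurable_sum _ fun i _ =>
      ((measurable_indicator_one (hmeas A hA)).comp (measurable_pi_apply i)).sub measurable_const
  set B : Set (ι → E) := {y | ∃ A ∈ 𝒜₀, t + √(v / 2) < |dev A y|}
  have hB : MeasurableSet B := measurableSet_exists_lt_abs hcount hdev _
  set D : Set ((ι → E) × (ι → E)) := {p | ∃ A ∈ 𝒜₀, t < |dev A p.1 - dev A p.2|}
  have hD : MeasurableSet D := measurableSet_exists_lt_abs hcount
    (f := fun A (p : (ι → E) × (ι → E)) => dev A p.1 - dev A p.2)
    (fun A hA => ((hdev A hA).comp measurable_fst).sub ((hdev A hA).comp measurable_snd)) _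
  have hQ : Measure.pi (fun i => (ν i).prod (ν i)) {z | ∃ A ∈ 𝒜₀, t < |∑ i,
        (A.indicator (fun _ => (1 : ℝ)) (z i).1 - A.indicator (fun _ => (1 : ℝ)) (z i).2)|}
      = ((Measure.pi ν).prod (Measure.pi ν)) D := by
    rw [← (measurePreserving_arrowProdEquivProdArrow E E ι ν ν).measure_preimage
      hD.nullMeasurableSet]
    congr 1
    ext z
    simp only [D, dev, Set.mem_ofPred_eq, Set.mem_preimage, ← Finset.sum_sub_distrib,
      sub_sub_sub_cancel_right]
    rfl
  rw [hQ, Measure.prod_apply hD]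
  -- Fix a set `A` at which `y` deviates. With probability at least one half the ghost sample
  -- deviates by at most `√(v / 2)` at this same `A`, and then the difference still exceeds `t`.
  have hslice (y : ι → E) (hy : y ∈ B) : 2⁻¹ ≤ Measure.pi ν (Prod.mk y ⁻¹' D) := by
    obtain ⟨A, hA, hlt⟩ := hy
    have hch := measure_pi_abs_sum_indicator_sub_le ν (hmeas A hA) hv hcard
    have hmC : MeasurableSet {y' : ι → E | √(v / 2) < |dev A y'|} :=
      measurableSet_lt measurable_const (continuous_abs.measurable.comp (hdev A hA))
    have hsub : {y' : ι → E | √(v / 2) < |dev A y'|}ᶜ ⊆ Prod.mk y ⁻¹' D := by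
      intro y' hy'
      have hy'' : |dev A y'| ≤ √(v / 2) := not_lt.1 hy'
      refine ⟨A, hA, ?_⟩
      have := abs_sub_abs_le_abs_sub (dev A y) (dev A y')
      simp only
      linarith
    refine le_trans ?_ (measure_mono hsub)
    rw [prob_compl_eq_one_sub hmC, ← ENNReal.one_sub_inv_two]
    exact tsub_le_tsub_left hch 1
  calc Measure.pi ν B = 2 * ∫⁻ _y in B, 2⁻¹ ∂(Measure.pi ν) := by
        rw [setLIntegral_const, ← mul_assoc, ENNReal.mul_inv_cancel (by simp) (by simp), one_mul]
    _ ≤ 2 * ∫⁻ y in B, Measure.pi ν (Prod.mk y ⁻¹' D) ∂(Measure.pi ν) := by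
        gcongr 2 * ?_
        exact setLIntegral_mono' hB hslice
    _ ≤ _ := by
        gcongr 2 * ?_
        exact setLIntegral_le_lintegral _ _

variable [Nonempty E]

/-- Tail bound for the supremum of the symmetrized process. -/
theorem measure_pi_exists_symm_le {𝒜 𝒜₀ : Set (Set E)} (h0 : 𝒜₀ ⊆ 𝒜) (hcount : 𝒜₀.Countable)
    (hmeas : ∀ A ∈ 𝒜₀, MeasurableSet A) {ι : Type*} [Fintype ι] (ν : ι → Measure E)
    [∀ i, IsProbabilityMeasure (ν i)] {m : ℕ} (hm : 2 * Fintype.card ι ≤ m) {v t : ℝ} (hv : 0 < v)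
    (hcard : Fintype.card ι ≤ v) (ht : 0 ≤ t) :
    Measure.pi (fun i => (ν i).prod (ν i)) {z | ∃ A ∈ 𝒜₀, t < |∑ i,
        (A.indicator (fun _ => (1 : ℝ)) (z i).1 - A.indicator (fun _ => (1 : ℝ)) (z i).2)|}
      ≤ ENNReal.ofReal (shatterCoeff 𝒜 m * (2 * Real.exp (-t ^ 2 / (2 * v)))) := by
  classical
  set Q := Measure.pi (fun i => (ν i).prod (ν i))
  set D : Set (ι → E × E) := {z | ∃ A ∈ 𝒜₀, t < |∑ i,
        (A.indicator (fun _ => (1 : ℝ)) (z i).1 - A.indicator (fun _ => (1 : ℝ)) (z i).2)|}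
  have hD : MeasurableSet D := by
    refine measurableSet_exists_lt_abs hcount (f := fun A (z : ι → E × E) => ∑ i,
        (A.indicator (fun _ => (1 : ℝ)) (z i).1 - A.indicator (fun _ => (1 : ℝ)) (z i).2))
        (fun A hA => ?_) t
    have := measurable_indicator_one (hmeas A hA)
    refine Finset.measurable_sum _ fun i _ => ?_
    exact (this.comp (measurable_fst.comp (measurable_pi_apply i))).sub
      (this.comp (measurable_snd.comp (measurable_pi_apply i)))
  -- Swapping coordinates within pairs preserves `Q` and flips the signs of the corresponding terms.
  -- Averaging over all swaps reduces the bound to a count of sign patterns for each fixed `z`.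
  let sw (b : Bool) : E × E → E × E := if b then id else Prod.swap
  let Φ (σ : ι → Bool) (z : ι → E × E) : ι → E × E := fun i => sw (σ i) (z i)
  have hΦ (σ : ι → Bool) : MeasurePreserving (Φ σ) Q Q := by
    refine measurePreserving_pi _ _ fun i => ?_
    by_cases h : σ i = true
    · simp only [sw, h, if_true]; exact MeasurePreserving.id _
    · simp only [sw, h]; exact Measure.measurePreserving_swap
  have hswap (A : Set E) (σ : ι → Bool) (z : ι → E × E) :
      ∑ i, (A.indicator (fun _ => (1 : ℝ)) (Φ σ z i).1
          - A.indicator (fun _ => (1 : ℝ)) (Φ σ z i).2)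
        = ∑ i, (if σ i then
        A.indicator (fun _ => (1 : ℝ)) (z i).1 - A.indicator (fun _ => (1 : ℝ)) (z i).2
      else -(A.indicator (fun _ => (1 : ℝ)) (z i).1
          - A.indicator (fun _ => (1 : ℝ)) (z i).2)) := by
    refine Finset.sum_congr rfl fun i _ => ?_
    by_cases h : σ i = true <;> simp [Φ, sw, h]
  have hind (σ : ι → Bool) : Q D = ∫⁻ z, D.indicator 1 (Φ σ z) ∂Q := by
    rw [(hΦ σ).lintegral_comp (measurable_one.indicator hD), lintegral_indicator_one hD]
  have hpt (z : ι → E × E) : ∑ σ : ι → Bool, D.indicator (1 : (ι → E × E) → ℝ≥0∞) (Φ σ z)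
      ≤ ENNReal.ofReal (2 ^ Fintype.card ι *
        (shatterCoeff 𝒜 m * (2 * Real.exp (-t ^ 2 / (2 * v))))) := by
    have e : ∑ σ : ι → Bool, D.indicator (1 : (ι → E × E) → ℝ≥0∞) (Φ σ z)
        = ((Finset.univ.filter fun σ => Φ σ z ∈ D).card : ℝ≥0∞) := by
      simp [Set.indicator_apply]
    rw [e, ← ENNReal.ofReal_natCast]
    refine ENNReal.ofReal_le_ofReal (card_swaps_le h0 z hm hv hcard ht _ fun σ hσ => ?_)
    obtain ⟨A, hA, hlt⟩ := (Finset.mem_filter.1 hσ).2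
    exact ⟨A, hA, by rwa [hswap A σ z] at hlt⟩
  have hsum : (2 : ℝ≥0∞) ^ Fintype.card ι * Q D ≤ 2 ^ Fintype.card ι *
      ENNReal.ofReal (shatterCoeff 𝒜 m * (2 * Real.exp (-t ^ 2 / (2 * v)))) := by
    calc (2 : ℝ≥0∞) ^ Fintype.card ι * Q D = ∑ _σ : ι → Bool, Q D := by simp
      _ = ∑ σ : ι → Bool, ∫⁻ z, D.indicator 1 (Φ σ z) ∂Q := Finset.sum_congr rfl fun σ _ => hind σ
      _ = ∫⁻ z, ∑ σ : ι → Bool, D.indicator 1 (Φ σ z) ∂Q := by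
          rw [lintegral_finsetSum]
          exact fun σ _ => (measurable_one.indicator hD).comp (hΦ σ).measurable
      _ ≤ ∫⁻ _z, ENNReal.ofReal (2 ^ Fintype.card ι *
        (shatterCoeff 𝒜 m * (2 * Real.exp (-t ^ 2 / (2 * v))))) ∂Q := lintegral_mono hpt
      _ = _ := by
          rw [lintegral_const, measure_univ, mul_one, ENNReal.ofReal_mul (by positivity),
            ENNReal.ofReal_pow (by positivity)]
          simp
  exact (ENNReal.mul_le_mul_iff_right (by simp) (by simp)).1 hsum

/-- A Vapnik–Chervonenkis inequality for independent, not necessarily identically distributed,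
random elements. -/
theorem measure_exists_dev_le {𝒜 𝒜₀ : Set (Set E)} (h0 : 𝒜₀ ⊆ 𝒜) (hcount : 𝒜₀.Countable)
    (hmeas : ∀ A ∈ 𝒜₀, MeasurableSet A) {ι Ω : Type*} [Fintype ι] [MeasurableSpace Ω]
    {P : Measure Ω} {Y : ι → Ω → E} (hY : ∀ i, Measurable (Y i)) (hindep : iIndepFun Y P)
    {m : ℕ} (hm : 2 * Fintype.card ι ≤ m) {v t : ℝ} (hv : 0 < v)
    (hcard : Fintype.card ι ≤ v) (ht : 0 ≤ t) :
    P {ω | ∃ A ∈ 𝒜₀, t + √(v / 2) <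
        |∑ i, (A.indicator (fun _ => (1 : ℝ)) (Y i ω) - P.real (Y i ⁻¹' A))|}
      ≤ ENNReal.ofReal (4 * shatterCoeff 𝒜 m * Real.exp (-t ^ 2 / (2 * v))) := by
  have := hindep.isProbabilityMeasure
  have hprob (i : ι) : IsProbabilityMeasure (P.map (Y i)) :=
    Measure.isProbabilityMeasure_map (hY i).aemeasurable
  have hmap := hindep.map_fun_eq_pi_map fun i => (hY i).aemeasurable
  have hmB : MeasurableSet {y : ι → E | ∃ A ∈ 𝒜₀, t + √(v / 2) <
      |∑ i, (A.indicator (fun _ => (1 : ℝ)) (y i) - (P.map (Y i)).real A)|} :=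
    measurableSet_exists_lt_abs hcount (fun A hA => Finset.measurable_sum _ fun i _ =>
      ((measurable_indicator_one (hmeas A hA)).comp (measurable_pi_apply i)).sub
        measurable_const) _
  have e : {ω | ∃ A ∈ 𝒜₀, t + √(v / 2) <
        |∑ i, (A.indicator (fun _ => (1 : ℝ)) (Y i ω) - P.real (Y i ⁻¹' A))|}
      = (fun ω i => Y i ω) ⁻¹' {y : ι → E | ∃ A ∈ 𝒜₀, t + √(v / 2) <
      |∑ i, (A.indicator (fun _ => (1 : ℝ)) (y i) - (P.map (Y i)).real A)|} := by
    ext ω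
    simp only [Set.mem_ofPred_eq, Set.mem_preimage]
    refine exists_congr fun A => and_congr_right fun hA => ?_
    simp_rw [map_measureReal_apply (hY _) (hmeas A hA)]
  rw [e, ← Measure.map_apply (measurable_pi_lambda _ hY) hmB, hmap]
  refine (measure_pi_exists_le_two_mul hcount hmeas _ hv hcard t).trans ?_
  refine (mul_le_mul_right (measure_pi_exists_symm_le h0 hcount hmeas _ hm hv hcard ht) 2).trans ?_
  rw [← ENNReal.ofReal_ofNat, ← ENNReal.ofReal_mul (by norm_num)]
  refine ENNReal.ofReal_le_ofReal (le_of_eq ?_)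
  ring

end VapnikChervonenkis

/-! ### Bernstein's inequality -/

/-- Third-order Taylor remainder; `2 / 9` is `4 / (3! * 3)` from `Real.exp_bound`. -/
theorem exp_sub_one_sub_le {x : ℝ} (hx : |x| ≤ 1) :
    Real.exp x - 1 - x ≤ x ^ 2 / 2 + 2 / 9 * |x| ^ 3 := by
  have h := (abs_le.1 (Real.exp_bound hx (n := 3) (by norm_num))).2
  norm_num [Finset.sum_range_succ, Nat.factorial] at h
  linarith

/-- The optimization behind Bernstein's inequality. -/
theorem exists_bernstein_exponent {v l : ℝ} (hv : 0 < v) (hl : 0 ≤ l) (hlv : 4 * l ≤ v) :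
    ∃ s : ℝ, 0 ≤ s ∧ s ≤ 1 ∧
      v * (s ^ 2 / 2 + 2 / 9 * s ^ 3) - s * (2 / 3 * l + √(2 * v * l)) ≤ -l := by
  set u := √(2 * l / v)
  have hu0 : 0 ≤ u := Real.sqrt_nonneg _
  have hu2 : u ^ 2 = 2 * l / v := Real.sq_sqrt (by positivity)
  have hlu : l = v * u ^ 2 / 2 := by rw [hu2]; field_simp
  have hsq : √(2 * v * l) = v * u := by
    rw [hlu, show 2 * v * (v * u ^ 2 / 2) = (v * u) ^ 2 by ring, Real.sqrt_sq (by positivity)]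
  have hu1 : u ≤ 1 := by
    rw [← abs_of_nonneg hu0, ← sq_le_one_iff_abs_le_one, hu2, div_le_one hv]
    linarith
  -- In terms of `u` the linear term is `v * s * u * (1 + u / 3)`. Once the quadratic and cubic
  -- terms are bounded by `v * s * u / 2`, what remains is `-v * s * u * (1 + 2 / 3 * u) / 2`, which
  -- this `s` makes equal to `-l`.
  set s := u / (1 + 2 / 3 * u)
  have hs0 : 0 ≤ s := by positivity
  have hsu : s * (1 + 2 / 3 * u) = u := by
    simp only [s]; field_simp
  have hs_le : s ≤ u := by nlinarith [mul_nonneg hs0 hu0]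
  refine ⟨s, hs0, hs_le.trans hu1, ?_⟩
  rw [hsq, hlu]
  have h1 : s ^ 2 / 2 + 2 / 9 * s ^ 3 ≤ s * u / 2 := by
    have h2 : s * s ≤ s * u := mul_le_mul_of_nonneg_left hs_le hs0
    have h3 : s / 2 + 2 / 9 * s ^ 2 ≤ u / 2 := by nlinarith [mul_nonneg hs0 hu0]
    nlinarith [mul_le_mul_of_nonneg_left h3 hs0]
  have h4 := mul_le_mul_of_nonneg_left h1 hv.le
  have h5 : s * u * (1 + 2 / 3 * u) = u ^ 2 := by rw [mul_right_comm, hsu, sq]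
  have h6 : v * (s * u / 2) - s * (2 / 3 * (v * u ^ 2 / 2) + v * u)
      = -(v * (s * u * (1 + 2 / 3 * u)) / 2) := by ring
  rw [h5] at h6
  linarith

section Bernstein

variable {E : Type*} [MeasurableSpace E] {n : ℕ} {Ω : Type*} [MeasurableSpace Ω]
  {P : Measure Ω} {X : Fin n → Ω → E} {R : Set E} {p : ℝ}

theorem mgf_sum_indicator_le (hX : ∀ i, Measurable (X i)) (hindep : iIndepFun X P)
    (hR : MeasurableSet R) (hp : ∀ i, P.real (X i ⁻¹' R) = p) (s : ℝ) :
    mgf (∑ i, fun ω => R.indicator (fun _ => (1 : ℝ)) (X i ω)) P s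
      ≤ Real.exp (n * p * (Real.exp s - 1)) := by
  have := hindep.isProbabilityMeasure
  have hm := measurable_indicator_one hR
  have h1 : iIndepFun (fun i ω => R.indicator (fun _ => (1 : ℝ)) (X i ω)) P :=
    hindep.comp (fun _ => R.indicator fun _ => (1 : ℝ)) fun _ => hm
  rw [h1.mgf_sum (fun i => hm.comp (hX i))]
  have h2 (i : Fin n) : mgf (fun ω => R.indicator (fun _ => (1 : ℝ)) (X i ω)) P s
      = 1 + p * (Real.exp s - 1) := by
    have e : (fun ω => Real.exp (s * R.indicator (fun _ => (1 : ℝ)) (X i ω)))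
        = fun ω => 1 + (X i ⁻¹' R).indicator (fun _ => Real.exp s - 1) ω := by
      funext ω
      by_cases h : X i ω ∈ R <;> simp [h]
    rw [mgf, e, integral_add (integrable_const _)
      ((integrable_const _).indicator (hX i hR)), integral_indicator_const _ (hX i hR), hp i]
    simp
  calc _ = ∏ _i : Fin n, (1 + p * (Real.exp s - 1)) := Finset.prod_congr rfl fun i _ => h2 i
    _ ≤ ∏ _i : Fin n, Real.exp (p * (Real.exp s - 1)) := by
        refine Finset.prod_le_prod (fun i _ => ?_) fun i _ => ?_
        -- The factor is nonnegative because it is a moment generating function.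
        · rw [← h2 i]; exact mgf_nonneg
        · rw [add_comm]; exact Real.add_one_le_exp _
    _ = _ := by
        rw [Finset.prod_const, ← Real.exp_nat_mul, Finset.card_univ, Fintype.card_fin, mul_assoc]

/-- Bernstein's inequality for the number of points in a set. -/
theorem measureReal_bernstein_le (hX : ∀ i, Measurable (X i)) (hindep : iIndepFun X P)
    (hR : MeasurableSet R) (hp : ∀ i, P.real (X i ⁻¹' R) = p) {l : ℝ} (hv : 0 < n * p)
    (hl : 0 ≤ l) (hlv : 4 * l ≤ n * p) :
    P.real {ω | 2 / 3 * l + √(2 * (n * p) * l)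
        < |∑ i, R.indicator (fun _ => (1 : ℝ)) (X i ω) - n * p|} ≤ 2 * Real.exp (-l) := by
  have := hindep.isProbabilityMeasure
  have hm := measurable_indicator_one hR
  obtain ⟨s, hs0, hs1, hs⟩ := exists_bernstein_exponent hv hl hlv
  set r := 2 / 3 * l + √(2 * (n * p) * l)
  set N : Ω → ℝ := ∑ i, fun ω => R.indicator (fun _ => (1 : ℝ)) (X i ω)
  have hNapp (ω : Ω) : N ω = ∑ i, R.indicator (fun _ => (1 : ℝ)) (X i ω) := by
    simp [N]
  have hNm : Measurable N := by
    rw [show N = _ from funext hNapp]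
    exact Finset.measurable_sum _ fun i _ => hm.comp (hX i)
  have hNb (ω : Ω) : N ω ∈ Set.Icc (0 : ℝ) n := by
    rw [hNapp]
    refine ⟨Finset.sum_nonneg fun i _ => (indicator_one_mem_Icc R _).1, ?_⟩
    calc _ ≤ ∑ _i : Fin n, (1 : ℝ) := Finset.sum_le_sum fun i _ => (indicator_one_mem_Icc R _).2
      _ = n := by simp
  have hint (c : ℝ) : Integrable (fun ω => Real.exp (c * N ω)) P :=
    integrable_exp_mul_of_mem_Icc hNm.aemeasurable (.of_forall hNb)
  -- The Taylor bound depends only on `|c|`, so `c = s` and `c = -s` give both tails.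
  have key (c : ℝ) (hc : |c| = s) : n * p * (Real.exp c - 1 - c) - s * r ≤ -l := by
    have h1 := exp_sub_one_sub_le (x := c) (hc ▸ hs1)
    rw [hc, ← sq_abs, hc] at h1
    linarith [mul_le_mul_of_nonneg_left h1 hv.le]
  have hup : P.real {ω | n * p + r ≤ N ω} ≤ Real.exp (-l) := by
    refine (measure_ge_le_exp_mul_mgf _ hs0 (hint s)).trans ?_
    refine (mul_le_mul_of_nonneg_left (mgf_sum_indicator_le hX hindep hR hp s)
      (Real.exp_pos _).le).trans ?_
    rw [← Real.exp_add, Real.exp_le_exp]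
    linarith [key s (abs_of_nonneg hs0)]
  have hlow : P.real {ω | N ω ≤ n * p - r} ≤ Real.exp (-l) := by
    refine (measure_le_le_exp_mul_mgf _ (neg_nonpos.2 hs0) (hint (-s))).trans ?_
    refine (mul_le_mul_of_nonneg_left (mgf_sum_indicator_le hX hindep hR hp (-s))
      (Real.exp_pos _).le).trans ?_
    rw [← Real.exp_add, Real.exp_le_exp]
    linarith [key (-s) (by rw [abs_neg, abs_of_nonneg hs0])]
  calc _ ≤ P.real ({ω | n * p + r ≤ N ω} ∪ {ω | N ω ≤ n * p - r}) := by
        refine measureReal_mono fun ω hω => ?_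
        rw [Set.mem_ofPred_eq, ← hNapp] at hω
        rcases lt_abs.1 hω with h | h
        · exact Or.inl (show n * p + r ≤ N ω by linarith)
        · exact Or.inr (show N ω ≤ n * p - r by linarith)
    _ ≤ _ := measureReal_union_le _ _
    _ ≤ _ := by linarith

end Bernstein

/-! ### Empirical measures and pointwise limits of sets -/

theorem empiricalMeasure_real {E : Type*} [MeasurableSpace E] {n : ℕ} (x : Fin n → E) {A : Set E}
    (hA : MeasurableSet A) :
    (empiricalMeasure x).real A = (∑ i, A.indicator (fun _ => (1 : ℝ)) (x i)) / n := by
  have h (i : Fin n) : (A.indicator (1 : E → ℝ≥0∞) (x i)).toReal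
      = A.indicator (fun _ => (1 : ℝ)) (x i) := by
    by_cases h : x i ∈ A <;> simp [h]
  have hne (i : Fin n) : A.indicator (1 : E → ℝ≥0∞) (x i) ≠ ∞ := by
    by_cases h : x i ∈ A <;> simp [h]
  rw [measureReal_def, empiricalMeasure]
  simp only [Measure.smul_apply, Measure.coe_finsetSum, Finset.sum_apply,
    Measure.dirac_apply' _ hA, smul_eq_mul, ENNReal.toReal_mul]
  rw [ENNReal.toReal_sum fun i _ => hne i]
  simp_rw [h]
  rw [ENNReal.toReal_inv, ENNReal.toReal_natCast, div_eq_inv_mul]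

theorem isFiniteMeasure_empiricalMeasure {E : Type*} [MeasurableSpace E] {n : ℕ} (hn : n ≠ 0)
    (x : Fin n → E) : IsFiniteMeasure (empiricalMeasure x) := by
  constructor
  rw [empiricalMeasure, Measure.smul_apply, smul_eq_mul]
  exact ENNReal.mul_lt_top (by simp [Nat.pos_of_ne_zero hn]) (measure_lt_top _ _)

/-- A deviation bound over a pointwise dense subclass extends to the whole class. -/
theorem abs_sub_le_of_tendsto_indicator {E : Type*} [MeasurableSpace E] {ρ ν : Measure E}
    [IsFiniteMeasure ρ] [IsFiniteMeasure ν] {A : Set E} {B : ℕ → Set E}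
    (hA : MeasurableSet A) (hB : ∀ k, MeasurableSet (B k))
    (hlim : ∀ x, Tendsto (fun k => (B k).indicator (fun _ => (1 : ℝ)) x) atTop
      (𝓝 (A.indicator (fun _ => (1 : ℝ)) x))) {r : ℝ}
    (hr : ∀ k, |ρ.real (B k) - ν.real (B k)| ≤ r) : |ρ.real A - ν.real A| ≤ r := by
  have hev : ∀ x, ∀ᶠ k in atTop, x ∈ B k ↔ x ∈ A :=
    (tendsto_indicator_const_iff_forall_eventually (b := (1 : ℝ)) atTop).1
      (tendsto_pi_nhds.2 hlim)
  have h (η : Measure E) [IsFiniteMeasure η] :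
      Tendsto (fun k => η.real (B k)) atTop (𝓝 (η.real A)) :=
    (ENNReal.tendsto_toReal (measure_ne_top η A)).comp
      (tendsto_measure_of_ae_tendsto_indicator_of_isFiniteMeasure atTop hA hB (.of_forall hev))
  exact le_of_tendsto ((h ρ).sub (h ν)).abs (.of_forall hr)

/-! ### Conditioning on which points fall into `R` -/

/-- The event that the points falling into `R` are exactly those with index in `I`. -/
def patternEvent {E Ω : Type*} {n : ℕ} (X : Fin n → Ω → E) (R : Set E) (I : Finset (Fin n)) :
    Set Ω :=
  ⋂ i, X i ⁻¹' (if i ∈ I then R else Rᶜ)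

theorem mem_patternEvent {E Ω : Type*} {n : ℕ} {X : Fin n → Ω → E} {R : Set E}
    {I : Finset (Fin n)} {ω : Ω} :
    ω ∈ patternEvent X R I ↔ ∀ i, X i ω ∈ R ↔ i ∈ I := by
  simp only [patternEvent, Set.mem_iInter, Set.mem_preimage]
  refine forall_congr' fun i => ?_
  by_cases h : i ∈ I <;> simp [h]

section Pattern

variable {E : Type*} [MeasurableSpace E] {n : ℕ} {Ω : Type*} [MeasurableSpace Ω]
  {P : Measure Ω} {X : Fin n → Ω → E} {R : Set E}

theorem measurableSet_patternEvent (hX : ∀ i, Measurable (X i)) (hR : MeasurableSet R)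
    (I : Finset (Fin n)) : MeasurableSet (patternEvent X R I) := by
  refine MeasurableSet.iInter fun i => hX i ?_
  split_ifs
  exacts [hR, hR.compl]

theorem sum_measure_patternEvent_le [IsProbabilityMeasure P] (hX : ∀ i, Measurable (X i))
    (hR : MeasurableSet R) : ∑ I : Finset (Fin n), P (patternEvent X R I) ≤ 1 := by
  rw [← measure_biUnion_finset _ fun I _ => measurableSet_patternEvent hX hR I]
  · exact prob_le_one
  · intro I _ J _ hIJ
    refine Set.disjoint_left.2 fun ω hI hJ => hIJ (Finset.ext fun i => ?_)
    rw [← mem_patternEvent.1 hI i, mem_patternEvent.1 hJ i]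

/-- The conditioning event is an intersection of events each involving a single `X i`, so the joint
law stays a product. -/
theorem iIndepFun_cond_patternEvent (hX : ∀ i, Measurable (X i)) (hindep : iIndepFun X P)
    (hR : MeasurableSet R) {I : Finset (Fin n)} (hI : P (patternEvent X R I) ≠ 0) :
    iIndepFun X P[|patternEvent X R I] := by
  -- The conditioning variables are the `X i` themselves, hence the diagonal pairs.
  refine iIndepFun.cond hX (hindep.comp (fun _ x => (x, x)) fun _ => by fun_prop)
    (fun i h => hI ?_) fun i => ?_
  · exact measure_mono_null (Set.iInter_subset _ i) h
  · split_ifs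
    exacts [hR, hR.compl]

/-- By independence only the constraint on the index `i` itself affects `X i`. -/
theorem cond_patternEvent_real (hX : ∀ i, Measurable (X i)) (hindep : iIndepFun X P)
    (hR : MeasurableSet R) {I : Finset (Fin n)} (hI : P (patternEvent X R I) ≠ 0)
    {i : Fin n} (hi : i ∈ I) {A : Set E} (hA : MeasurableSet A)
    (hAR : A ⊆ R) :
    P[|patternEvent X R I].real (X i ⁻¹' A) = P.real (X i ⁻¹' A) / P.real (X i ⁻¹' R) := by
  have h := cond_iInter (μ := P) (X := X) (Y := X) (s := {i}) (f := fun j => X j ⁻¹' A)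
    (t := fun j => if j ∈ I then R else Rᶜ) hX
    (hindep.comp (fun _ x => (x, x)) fun _ => by fun_prop)
    (fun j _ => ⟨A, hA, rfl⟩) (fun j _ h => hI (measure_mono_null (Set.iInter_subset _ j) h))
    (fun j => by split_ifs; exacts [hR, hR.compl])
  simp only [Finset.mem_singleton, Set.iInter_iInter_eq_left, Finset.prod_singleton, hi,
    if_true] at h
  rw [measureReal_def, patternEvent, h, cond_apply (hX i hR),
    Set.inter_eq_right.2 (Set.preimage_mono hAR), ENNReal.toReal_mul, ENNReal.toReal_inv,
    ← measureReal_def, ← measureReal_def, div_eq_inv_mul]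

end Pattern

/-- Deviation of the counts of points in small sets from their conditional expectations
given the number of points in `R`. -/
theorem measure_exists_conditional_dev_le {E : Type*} [MeasurableSpace E] [Nonempty E] {n : ℕ}
    {Ω : Type*} [MeasurableSpace Ω] {P : Measure Ω} {X : Fin n → Ω → E} {R : Set E}
    {μ : Measure E} (hX : ∀ i, Measurable (X i)) (hindep : iIndepFun X P)
    (hlaw : ∀ i, P.map (X i) = μ) (hR : MeasurableSet R) {𝒜 𝒜₀ : Set (Set E)} (h0 : 𝒜₀ ⊆ 𝒜)
    (hcount : 𝒜₀.Countable) (hmeas : ∀ A ∈ 𝒜₀, MeasurableSet A) (hAR : ∀ A ∈ 𝒜₀, A ⊆ R)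
    {v t : ℝ} (hv : 0 < v) (ht : 0 ≤ t) :
    P {ω | ∑ i, R.indicator (fun _ => (1 : ℝ)) (X i ω) ≤ v ∧ ∃ A ∈ 𝒜₀, t + √(v / 2) <
        |∑ i, A.indicator (fun _ => (1 : ℝ)) (X i ω)
          - (∑ i, R.indicator (fun _ => (1 : ℝ)) (X i ω)) * (μ.real A / μ.real R)|}
      ≤ ENNReal.ofReal (4 * shatterCoeff 𝒜 ⌊2 * v⌋₊ * Real.exp (-t ^ 2 / (2 * v))) := by
  classical
  have := hindep.isProbabilityMeasure
  set G : Set Ω := {ω | ∑ i, R.indicator (fun _ => (1 : ℝ)) (X i ω) ≤ v ∧ ∃ A ∈ 𝒜₀, t + √(v / 2) <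
        |∑ i, A.indicator (fun _ => (1 : ℝ)) (X i ω)
          - (∑ i, R.indicator (fun _ => (1 : ℝ)) (X i ω)) * (μ.real A / μ.real R)|}
  set c := ENNReal.ofReal (4 * shatterCoeff 𝒜 ⌊2 * v⌋₊ * Real.exp (-t ^ 2 / (2 * v)))
  -- The factor `c` is the same for all `I`, so summing over the disjoint patterns loses nothing.
  -- Patterns with more than `v` indices do not meet `G`.
  have hpat (I : Finset (Fin n)) : P (patternEvent X R I ∩ G) ≤ P (patternEvent X R I) * c := by
    have hsum {ω : Ω} (hω : ω ∈ patternEvent X R I) {A : Set E} (hA : A ⊆ R) :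
        ∑ i, A.indicator (fun _ => (1 : ℝ)) (X i ω)
          = ∑ i : I, A.indicator (fun _ => (1 : ℝ)) (X i ω) := by
      rw [Finset.sum_coe_sort I fun i => A.indicator (fun _ => (1 : ℝ)) (X i ω)]
      refine (Finset.sum_subset (Finset.subset_univ I) fun i _ hi => ?_).symm
      exact Set.indicator_of_notMem (fun h => hi ((mem_patternEvent.1 hω i).1 (hA h))) _
    have hN {ω : Ω} (hω : ω ∈ patternEvent X R I) :
        ∑ i, R.indicator (fun _ => (1 : ℝ)) (X i ω) = I.card := by
      rw [hsum hω subset_rfl, Finset.sum_congr rfl fun (i : I) _ =>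
        Set.indicator_of_mem ((mem_patternEvent.1 hω i).2 i.property) _]
      simp
    by_cases hI : P (patternEvent X R I) = 0
    · rw [measure_mono_null Set.inter_subset_left hI]
      exact zero_le
    by_cases hcard : (I.card : ℝ) ≤ v
    · have hV := measure_exists_dev_le h0 hcount hmeas (Y := fun i : I => X i)
        (fun i => hX i) ((iIndepFun_cond_patternEvent hX hindep hR hI).precomp
          Subtype.val_injective) (m := ⌊2 * v⌋₊)
        (Nat.le_floor (by push_cast [Fintype.card_coe]; linarith)) hv
        (by simpa using hcard) ht
      have hEm := measurableSet_patternEvent hX hR I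
      rw [← cond_mul_eq_inter hEm, mul_comm]
      gcongr
      rw [← cond_inter_self hEm]
      refine (measure_mono ?_).trans hV
      rintro ω ⟨hω, -, A, hA, hlt⟩
      refine ⟨A, hA, hlt.trans_eq ?_⟩
      rw [hN hω, hsum hω (hAR A hA), Finset.sum_sub_distrib]
      congr 2
      rw [Finset.sum_congr rfl fun (i : I) _ =>
        cond_patternEvent_real hX hindep hR hI i.property (hmeas A hA) (hAR A hA)]
      simp_rw [← map_measureReal_apply (hX _) (hmeas A hA), ← map_measureReal_apply (hX _) hR,
        hlaw]
      simp
    · have : patternEvent X R I ∩ G = ∅ := by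
        refine Set.eq_empty_of_forall_notMem fun ω hω => hcard ?_
        rw [← hN hω.1]
        exact hω.2.1
      rw [this, measure_empty]
      exact zero_le
  calc P G ≤ P (⋃ I ∈ (Finset.univ : Finset (Finset (Fin n))), patternEvent X R I ∩ G) := by
        refine measure_mono fun ω hω => ?_
        refine Set.mem_biUnion (x := Finset.univ.filter fun i => X i ω ∈ R) (Finset.mem_univ _)
          ⟨mem_patternEvent.2 fun i => ?_, hω⟩
        simp
    _ ≤ ∑ I : Finset (Fin n), P (patternEvent X R I ∩ G) := measure_biUnion_finset_le _ _
    _ ≤ ∑ I : Finset (Fin n), P (patternEvent X R I) * c := Finset.sum_le_sum fun I _ => hpat I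
    _ = (∑ I : Finset (Fin n), P (patternEvent X R I)) * c := (Finset.sum_mul ..).symm
    _ ≤ 1 * c := by
        gcongr
        exact sum_measure_patternEvent_le hX hR
    _ = c := one_mul c

end RareVC

/-! ### Combining the two deviation bounds -/

theorem mainTheorem3 {d n : ℕ} {Ω : Type*} [MeasurableSpace Ω]
    (P : Measure Ω) [IsProbabilityMeasure P]
    (μ : Measure (EuclideanSpace ℝ (Fin d))) [IsProbabilityMeasure μ]
    (X : Fin n → Ω → EuclideanSpace ℝ (Fin d))
    (hX_meas : ∀ i, Measurable (X i))
    (hX_indep : iIndepFun X P)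
    (hX_law : ∀ i, P.map (X i) = μ)
    (𝒜 : Set (Set (EuclideanSpace ℝ (Fin d))))
    (h𝒜_nonempty : 𝒜.Nonempty)
    (h𝒜_borel : ∀ A ∈ 𝒜, MeasurableSet A)
    (h𝒜_pm : RareVC.PointwiseMeasurable 𝒜)
    (R : Set (EuclideanSpace ℝ (Fin d)))
    (hR_borel : MeasurableSet R)
    (hR : ∀ A ∈ 𝒜, A ⊆ R)
    (p : ℝ) (hp : p = μ.real R)
    (δ : ℝ) (hδ0 : 0 < δ) (hδ1 : δ < 1)
    (hnp : 4 * Real.log (4 / δ) ≤ n * p) :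
    1 - δ ≤ P.real {ω | (⨆ A : 𝒜,
        |(RareVC.empiricalMeasure (fun i => X i ω)).real (A : Set (EuclideanSpace ℝ (Fin d)))
          - μ.real (A : Set (EuclideanSpace ℝ (Fin d)))|)
      ≤ 2 / (3 * n) * Real.log (4 / δ)
        + √(p / n) * (√(2 * Real.log (4 / δ))
          + 2 * √(Real.log (8 / δ) + Real.log (RareVC.shatterCoeffReal 𝒜 (4 * n * p))) + 1)} := by
  obtain ⟨𝒜₀, h0, hcount, hdense⟩ := h𝒜_pm
  have hl : 0 < Real.log (4 / δ) := Real.log_pos (by rw [lt_div_iff₀ hδ0]; linarith)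
  set l := Real.log (4 / δ)
  have hv : 0 < n * p := by linarith
  have hp0 : 0 ≤ p := hp ▸ measureReal_nonneg
  have hn0 : n ≠ 0 := by rintro rfl; simp at hv
  have hn : (0 : ℝ) < n := by positivity
  have hppos : 0 < p := (pos_iff_pos_of_mul_pos hv).1 hn
  set S := RareVC.shatterCoeffReal 𝒜 (4 * n * p)
  have hS : (1 : ℝ) ≤ S := by exact_mod_cast RareVC.shatterCoeff_pos h𝒜_nonempty _
  set M := Real.log (8 / δ) + Real.log S
  have hM0 : 0 ≤ M := add_nonneg (Real.log_nonneg (by rw [le_div_iff₀ hδ0]; linarith))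
    (Real.log_nonneg hS)
  have hexpM : Real.exp (-M) = δ / (8 * S) := by
    rw [Real.exp_neg, Real.exp_add, Real.exp_log (by positivity), Real.exp_log (by positivity)]
    field_simp
  set r := 2 / 3 * l + √(2 * (n * p) * l)
  -- With `v = 2 * (n * p)` this gives `t ^ 2 / (2 * v) = M`, and `4 * S * exp (-M) = δ / 2`.
  set t := √(4 * (n * p) * M)
  set N : Ω → ℝ := fun ω => ∑ i, R.indicator (fun _ => (1 : ℝ)) (X i ω)
  set B₁ : Set Ω := {ω | r < |N ω - n * p|}
  set B₂ : Set Ω := {ω | N ω ≤ 2 * (n * p) ∧ ∃ A ∈ 𝒜₀, t + √(2 * (n * p) / 2) <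
        |∑ i, A.indicator (fun _ => (1 : ℝ)) (X i ω) - N ω * (μ.real A / μ.real R)|}
  have hB₁ : P.real B₁ ≤ δ / 2 := by
    refine (RareVC.measureReal_bernstein_le hX_meas hX_indep hR_borel (fun i => ?_) hv hl.le
      hnp).trans_eq ?_
    · rw [hp, ← map_measureReal_apply (hX_meas i) hR_borel, hX_law i]
    · rw [Real.exp_neg, Real.exp_log (by positivity)]
      field_simp
      norm_num
  have hB₂ : P.real B₂ ≤ δ / 2 := by
    have h := RareVC.measure_exists_conditional_dev_le (v := 2 * (n * p)) (t := t) hX_meas hX_indep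
      hX_law hR_borel h0 hcount (fun A hA => h𝒜_borel A (h0 hA)) (fun A hA => hR A (h0 hA))
      (by positivity) (Real.sqrt_nonneg _)
    have hSe : RareVC.shatterCoeff 𝒜 ⌊2 * (2 * (n * p))⌋₊ = S := by
      simp only [S, RareVC.shatterCoeffReal]
      congr 2
      ring
    have he : 4 * (S : ℝ) * Real.exp (-t ^ 2 / (2 * (2 * (n * p)))) = δ / 2 := by
      rw [Real.sq_sqrt (by positivity),
        show -(4 * (n * p) * M) / (2 * (2 * (n * p))) = -M by field_simp; ring, hexpM]
      field_simp
      norm_num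
    rw [hSe, he] at h
    exact ENNReal.toReal_le_of_le_ofReal (by positivity) h
  set T : Set Ω := {ω | (⨆ A : 𝒜,
        |(RareVC.empiricalMeasure (fun i => X i ω)).real (A : Set (EuclideanSpace ℝ (Fin d)))
          - μ.real (A : Set (EuclideanSpace ℝ (Fin d)))|)
      ≤ 2 / (3 * n) * l + √(p / n) * (√(2 * l) + 2 * √M + 1)}
  -- From `4 * l ≤ n * p`, the two terms of `r` are at most `1 / 6` and `1 / √2 ≤ 5 / 6` of `n * p`.
  -- This makes `N ≤ 2 * (n * p)` outside `B₁`.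
  have hr : r ≤ n * p := by
    have h1 : √(2 * (n * p) * l) ≤ 5 / 6 * (n * p) := by
      rw [Real.sqrt_le_left (by positivity)]
      nlinarith
    simp only [r]
    linarith
  have hrhs : (t + √(2 * (n * p) / 2) + r) / n
      = 2 / (3 * n) * l + √(p / n) * (√(2 * l) + 2 * √M + 1) := by
    have hq : √(n * p) / n = √(p / n) := by
      rw [Real.sqrt_div' _ hn.le, Real.sqrt_mul hn.le]
      rw [div_eq_div_iff hn.ne' (Real.sqrt_pos.2 hn).ne', mul_right_comm,
        Real.mul_self_sqrt hn.le, mul_comm]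
    have ht : t = √(n * p) * (2 * √M) := by
      simp only [t]
      rw [show 4 * (n * p) * M = (n * p) * (2 ^ 2 * M) by ring, Real.sqrt_mul hv.le,
        Real.sqrt_mul (sq_nonneg (2 : ℝ)) M, Real.sqrt_sq (by norm_num)]
    have hr' : r = 2 / 3 * l + √(n * p) * √(2 * l) := by
      simp only [r]
      rw [show 2 * (n * p) * l = (n * p) * (2 * l) by ring, Real.sqrt_mul hv.le]
    rw [ht, hr', ← hq, mul_div_cancel_left₀ _ (two_ne_zero' ℝ)]
    field_simp
    ring
  -- Covering the space and using subadditivity avoids taking complements, so measurability of `T`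
  -- is not needed.
  have hcover : Set.univ ⊆ T ∪ (B₁ ∪ B₂) := by
    intro ω _
    by_contra hω
    simp only [Set.mem_union, not_or] at hω
    obtain ⟨hT, h1, h2⟩ := hω
    have h1' : |N ω - n * p| ≤ r := not_lt.1 h1
    have hN : N ω ≤ 2 * (n * p) := by linarith [(abs_le.1 h1').2]
    have := RareVC.isFiniteMeasure_empiricalMeasure hn0 fun i => X i ω
    have hdev : ∀ A ∈ 𝒜₀, |(RareVC.empiricalMeasure (fun i => X i ω)).real A - μ.real A|
        ≤ (t + √(2 * (n * p) / 2) + r) / n := by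
      intro A hA
      have h3 : |∑ i, A.indicator (fun _ => (1 : ℝ)) (X i ω) - N ω * (μ.real A / μ.real R)|
          ≤ t + √(2 * (n * p) / 2) := by
        by_contra hlt
        exact h2 ⟨hN, A, hA, not_le.1 hlt⟩
      rw [← hp] at h3
      have hle : μ.real A ≤ p := hp ▸ measureReal_mono (hR A (h0 hA))
      have h4 : |(N ω - n * p) * (μ.real A / p)| ≤ r := by
        rw [abs_mul, abs_of_nonneg (div_nonneg measureReal_nonneg hp0)]
        exact (mul_le_of_le_one_right (abs_nonneg _) ((div_le_one hppos).2 hle)).trans h1'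
      rw [RareVC.empiricalMeasure_real _ (h𝒜_borel A (h0 hA)), le_div_iff₀ hn,
        ← abs_of_pos hn, ← abs_mul, abs_of_pos hn]
      have e : ((∑ i, A.indicator (fun _ => (1 : ℝ)) (X i ω)) / n - μ.real A) * n
          = (∑ i, A.indicator (fun _ => (1 : ℝ)) (X i ω) - N ω * (μ.real A / p))
            + (N ω - n * p) * (μ.real A / p) := by
        field_simp
        ring
      rw [e]
      exact (abs_add_le _ _).trans (add_le_add h3 h4)
    have := h𝒜_nonempty.to_subtype
    refine hT ?_
    simp only [T, Set.mem_ofPred_eq]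
    refine ciSup_le fun A => ?_
    obtain ⟨B, hB, hlim⟩ := hdense A A.2
    rw [← hrhs]
    exact RareVC.abs_sub_le_of_tendsto_indicator (h𝒜_borel A A.2)
      (fun k => h𝒜_borel _ (h0 (hB k))) hlim fun k => hdev _ (hB k)
  have h1 : (1 : ℝ) ≤ P.real T + (P.real B₁ + P.real B₂) := by
    calc (1 : ℝ) = P.real Set.univ := probReal_univ.symm
      _ ≤ P.real (T ∪ (B₁ ∪ B₂)) := measureReal_mono hcover
      _ ≤ P.real T + P.real (B₁ ∪ B₂) := measureReal_union_le _ _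
      _ ≤ _ := by gcongr; exact measureReal_union_le _ _
  linarith
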